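/- Let $(\Omega,\Sigma)$ be a measurable space and let $f:\mathbb{R}\to(-\infty,\infty]$ be convex and lower semi-continuous, with $f(1)=0$, $f$ finite in a neighbourhood of $1$, and $f(x)=\infty$ for all $x<0$; let $f^*(s)=\sup_{x\in\mathbb{R}}\,(xs-f(x))$. Let $B(\Omega,\Sigma)$ be the set of bounded measurable functions $\Omega\to\mathbb{R}$ and $\mathcal{P}(\Omega,\Sigma)$ the set of finitely additive probability measures on $(\Omega,\Sigma)$. For $P'\in\mathcal{P}(\Omega,\Sigma)$ and a countably additive probability measure $Q$, write $P'\ll Q$ if $Q(E)=0$ implies $P'(E)=0$ for every $E\in\Sigma$, and let $$\bar D_f(P'\|Q)=\begin{cases}\displaystyle\int_\Omega f\!\left(\frac{dP'}{dQ}\right)dQ & \text{if } P' \text{ is countably additive and } P'\ll Q,\\[2mm] \displaystyle\sup_{h\in B(\Omega,\Sigma)}\big(\mathbb{E}_{P'}[h]-\mathbb{E}_Q[f^*(h)]\big)&\text{otherwise.}\end{cases}$$ Let $\varphi=(\varphi_1,\dots,\varphi_n)$ with $\varphi_i\in B(\Omega,\Sigma)$ for all $i$. Then for every $P\in\mathcal{P}(\Omega,\Sigma)$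 and every countably additive probability measure $Q$ on $(\Omega,\Sigma)$, the linear $f$-divergence with $A=\mathbb{R}^n$, $$D_{f,\varphi,\mathbb{R}^n}(P\|Q)=\sup_{a\in\mathbb{R}^n,\,b\in\mathbb{R}}\Big(\mathbb{E}_{P}\big[a^{\intercal}\varphi+b\big]-\mathbb{E}_{Q}\big[f^*(a^{\intercal}\varphi+b)\big]\Big),$$ satisfies $$D_{f,\varphi,\mathbb{R}^n}(P\|Q)=\inf_{\substack{P'\in\mathcal{P}(\Omega,\Sigma)\\ \mathbb{E}_{P'}[\varphi]=\mathbb{E}_P[\varphi]}}\bar D_f(P'\|Q)=\inf_{\substack{P'\in\mathcal{P}(\Omega,\Sigma)\\ \mathbb{E}_{P'}[\varphi]=\mathbb{E}_P[\varphi]\\ P'\ll Q}}\bar D_f(P'\|Q),$$ as an equality in $[-\infty,\infty]$, where the infimum of the empty set is $\infty$. -/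

import Mathlib

open MeasureTheory Set Filter Topology
open scoped ENNReal

namespace RestrictedFDiv

/-- The standing assumptions on the function `f : ℝ → (-∞, ∞]` generating an `f`-divergence: it is
convex, lower semi-continuous, finite in a neighbourhood of `1`, with `f 1 = 0` and `f x = ∞` for
`x < 0`. -/
structure IsDivergenceFunction (f : ℝ → EReal) : Prop where
  ne_bot : ∀ x, f x ≠ ⊥
  convex : ∀ x y a b : ℝ, 0 < a → 0 < b → a + b = 1 →
    f (a * x + b * y) ≤ (a : EReal) * f x + (b : EReal) * f y
  lsc : LowerSemicontinuous f
  map_one : f 1 = 0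
  finite_near_one : ∀ᶠ x in 𝓝 (1 : ℝ), f x ≠ ⊤
  top_of_neg : ∀ x : ℝ, x < 0 → f x = ⊤

/-- The convex conjugate `f^*(s) = sup_{x ∈ ℝ} (x s - f(x))`. -/
noncomputable def conj (f : ℝ → EReal) (s : ℝ) : EReal :=
  ⨆ x : ℝ, ((x * s : ℝ) : EReal) - f x

/-- The integral `∫ g dQ` in `[-∞, ∞]` of an extended real valued function, as the integral of the
positive part minus the integral of the negative part. -/
noncomputable def eintegral {Ω : Type*} [MeasurableSpace Ω] (Q : Measure Ω) (g : Ω → EReal) :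
    EReal :=
  ((∫⁻ x, (g x).toENNReal ∂Q : ℝ≥0∞) : EReal) - ((∫⁻ x, (-(g x)).toENNReal ∂Q : ℝ≥0∞) : EReal)

/-- The set `B(Ω, Σ)` of bounded measurable real functions. -/
def boundedMeasurable (Ω : Type*) [MeasurableSpace Ω] : Set (Ω → ℝ) :=
  {h | Measurable h ∧ ∃ C : ℝ, ∀ x, |h x| ≤ C}

/-- A finitely additive probability measure on the measurable sets of `Ω` (an element of
`𝒫(Ω, Σ)`). The values at non-measurable sets are irrelevant and never used. -/
structure FinAddProb (Ω : Type*) [MeasurableSpace Ω] extends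
    AddContent ℝ≥0∞ {s : Set Ω | MeasurableSet s} where
  map_univ : toFun Set.univ = 1

namespace FinAddProb

variable {Ω : Type*} [MeasurableSpace Ω]

/-- Countable additivity, on the measurable sets. -/
def IsCountablyAdditive (P : FinAddProb Ω) : Prop :=
  ∀ E : ℕ → Set Ω, (∀ i, MeasurableSet (E i)) → Pairwise (fun i j => Disjoint (E i) (E j)) →
    P.toFun (⋃ i, E i) = ∑' i, P.toFun (E i)

/-- The measure given by a countably additive `P`. -/
noncomputable def toMeasure (P : FinAddProb Ω) (hP : P.IsCountablyAdditive) : Measure Ω :=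
  Measure.ofMeasurable (fun s _ => P.toFun s) P.empty' (fun E hE hd => hP E hE hd)

/-- Absolute continuity `P ≪ Q`: `Q E = 0` implies `P E = 0` for measurable `E`. -/
def AbsCont (P : FinAddProb Ω) (Q : Measure Ω) : Prop :=
  ∀ E : Set Ω, MeasurableSet E → Q E = 0 → P.toFun E = 0

/-- The expectation `E_P[h]` of a bounded measurable function `h` under a finitely additive
probability measure: the supremum of `∑ y, y * P (s = y)` over the measurable simple functions
`s ≤ h`. -/
noncomputable def expect (P : FinAddProb Ω) (h : Ω → ℝ) : ℝ :=
  sSup {r : ℝ | ∃ s : SimpleFunc Ω ℝ, (∀ x, s x ≤ h x) ∧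
    r = ∑ y ∈ s.range, y * (P.toFun (s ⁻¹' {y})).toReal}

end FinAddProb

/-- The `f`-divergence `D_f(P ‖ Q) = ∫ f (dP/dQ) dQ` of measures `P ≪ Q`. -/
noncomputable def fDiv {Ω : Type*} [MeasurableSpace Ω] (f : ℝ → EReal) (P Q : Measure Ω) : EReal :=
  eintegral Q (fun x => f (P.rnDeriv Q x).toReal)

open Classical in
/-- The extended `f`-divergence of a finitely additive probability measure `P` from a probability
measure `Q`: it is `D_f(P ‖ Q)` when `P` is countably additive and `P ≪ Q`, and
`sup_{h ∈ B(Ω, Σ)} (E_P[h] - E_Q[f^*(h)])` otherwise. -/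
noncomputable def extFDiv {Ω : Type*} [MeasurableSpace Ω] (f : ℝ → EReal) (P : FinAddProb Ω)
    (Q : Measure Ω) : EReal :=
  if hP : P.IsCountablyAdditive ∧ P.AbsCont Q then
    fDiv f (P.toMeasure hP.1) Q
  else
    ⨆ h ∈ boundedMeasurable Ω, ((P.expect h : ℝ) : EReal) - eintegral Q (fun x => conj f (h x))

/-- The linear `f`-divergence `D_{f, φ, A}(P ‖ Q)`, the supremum over `a ∈ A` and `b ∈ ℝ` of
`E_P[aᵀφ + b] - E_Q[f^*(aᵀφ + b)]`. -/
noncomputable def linearFDiv {Ω : Type*} [MeasurableSpace Ω] {n : ℕ} (f : ℝ → EReal)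
    (φ : Fin n → Ω → ℝ) (A : Set (Fin n → ℝ)) (P : FinAddProb Ω) (Q : Measure Ω) : EReal :=
  ⨆ a ∈ A, ⨆ b : ℝ,
    ((P.expect (fun x => (∑ i, a i * φ i x) + b) : ℝ) : EReal) -
      eintegral Q (fun x => conj f ((∑ i, a i * φ i x) + b))

end RestrictedFDiv

namespace RestrictedFDiv

/-! ## Affine minorants -/

section

/-! The theorem is Fenchel duality on `B(Ω, Σ)`. For weak duality, a feasible `P'` has the same
expectation as `P` on the span `W` of `1` and the `φ i`, so every term of the linear divergence is a
term of the variational formula for `P'`. Such terms are at most the extended divergence, by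
definition or by the pointwise Fenchel inequality (`expect_sub_le_extFDiv`).

For strong duality, let `D` be the linear divergence, assumed finite. Then `E_P` on `W` is dominated
by the convex functional `h ↦ E_Q[f^*(h)] + D`, and a Hahn-Banach argument
(`exists_dominated_extension`) extends it to `B(Ω, Σ)` with the same domination. Since `f = ∞` on
the negative reals, domination forces the extension to be nonpositive on functions that are `Q`-a.e.
nonpositive (`nonpos_of_dominated`). Hence it is the expectation of some `P' ≪ Q`
(`exists_expect_eq`), and domination bounds the divergence of `P'` by `D`. When `P'` is countably
additive this last step needs the hard half of the variational formula (`fDiv_le_of_forall`). The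
minimiser `P'` is feasible for both infima.

Throughout, `E_Q[f^*(h)]` is handled through integrable `u` with `y * h - u ≤ f y` for all `y`,
which keeps the functional analysis real-valued. -/

/-- The affine function `x ↦ x * s - u` is a minorant of `t * f` on the effective domain of `f`. -/
def IsScaledMinorant (f : ℝ → EReal) (t s u : ℝ) : Prop :=
  ∀ x, f x ≠ ⊤ → x * s - u ≤ t * (f x).toReal

namespace IsScaledMinorant

variable {f : ℝ → EReal} {t t' s s' u u' c : ℝ}

lemma add (h : IsScaledMinorant f t s u) (h' : IsScaledMinorant f t' s' u') :
    IsScaledMinorant f (t + t') (s + s') (u + u') := fun x hx => by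
  linarith [h x hx, h' x hx]

lemma smul (hc : 0 ≤ c) (h : IsScaledMinorant f t s u) :
    IsScaledMinorant f (c * t) (c * s) (c * u) := fun x hx => by
  linarith [mul_le_mul_of_nonneg_left (h x hx) hc]

end IsScaledMinorant

namespace IsDivergenceFunction

variable {f : ℝ → EReal} {t s u : ℝ}

lemma coe_toReal (hf : IsDivergenceFunction f) {x : ℝ} (hx : f x ≠ ⊤) :
    ((f x).toReal : EReal) = f x := EReal.coe_toReal hx (hf.ne_bot x)

lemma nonneg_of_ne_top (hf : IsDivergenceFunction f) {x : ℝ} (hx : f x ≠ ⊤) : 0 ≤ x := by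
  by_contra h
  exact hx (hf.top_of_neg x (not_le.1 h))

lemma isScaledMinorant_iff (hf : IsDivergenceFunction f) :
    IsScaledMinorant f 1 s u ↔ ∀ x, ((x * s - u : ℝ) : EReal) ≤ f x := by
  refine forall_congr' fun x => ?_
  by_cases hx : f x = ⊤
  · simp [hx]
  · rw [← hf.coe_toReal hx, EReal.coe_le_coe_iff]
    simp

/-- Young's inequality rearranged: it trades bounds on the extended-valued conjugate for real affine
minorants. -/
lemma conj_le_coe_iff (hf : IsDivergenceFunction f) :
    conj f s ≤ (u : EReal) ↔ IsScaledMinorant f 1 s u := by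
  rw [hf.isScaledMinorant_iff, conj, iSup_le_iff]
  refine forall_congr' fun x => ?_
  by_cases hx : f x = ⊤
  · simp [hx]
  · rw [← hf.coe_toReal hx, ← EReal.coe_sub, EReal.coe_le_coe_iff, EReal.coe_le_coe_iff]
    constructor <;> intro h <;> linarith

/-- The effective domain lies in `[0, ∞)`, so lowering the slope lowers the affine function there.
Positivity of the dual functional comes from this. -/
lemma isScaledMinorant_mono (hf : IsDivergenceFunction f) {s' : ℝ} (hs : s ≤ s')
    (h : IsScaledMinorant f t s' u) : IsScaledMinorant f t s u := fun x hx => by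
  linarith [h x hx, mul_le_mul_of_nonneg_left hs (hf.nonneg_of_ne_top hx)]

lemma coe_le_conj (hf : IsDivergenceFunction f) (s : ℝ) : (s : EReal) ≤ conj f s := by
  refine le_trans ?_ (le_iSup _ (1 : ℝ))
  simp [hf.map_one]

lemma conj_mono (hf : IsDivergenceFunction f) : Monotone (conj f) := fun s s' h => by
  refine iSup_mono fun x => ?_
  by_cases hx : f x = ⊤
  · simp [hx]
  · exact EReal.sub_le_sub (EReal.coe_le_coe_iff.2
      (mul_le_mul_of_nonneg_left h (hf.nonneg_of_ne_top hx))) le_rfl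

lemma toReal_combo_le (hf : IsDivergenceFunction f) {x y a b : ℝ} (hx : f x ≠ ⊤) (hy : f y ≠ ⊤)
    (ha : 0 < a) (hb : 0 < b) (hab : a + b = 1) :
    f (a * x + b * y) ≤ ((a * (f x).toReal + b * (f y).toReal : ℝ) : EReal) := by
  have := hf.convex x y a b ha hb hab
  rw [← hf.coe_toReal hx, ← hf.coe_toReal hy] at this
  exact_mod_cast this

/-- A subgradient of `f` at `1`. -/
lemma exists_subgradient (hf : IsDivergenceFunction f) : ∃ s, IsScaledMinorant f 1 s s := by
  obtain ⟨ε, hε, hball⟩ := Metric.eventually_nhds_iff.1 hf.finite_near_one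
  have hfin : ∀ x, |x - 1| < ε → f x ≠ ⊤ := fun x hx => hball (by simpa [Real.dist_eq] using hx)
  -- Writing `1` as a convex combination of `x` and `y` and using `f 1 = 0`: chord slopes to the
  -- left of `1` are at most those to the right. The supremum of the left slopes is then a
  -- subgradient.
  have key : ∀ x y, f x ≠ ⊤ → f y ≠ ⊤ → x < 1 → 1 < y →
      -(f x).toReal / (1 - x) ≤ (f y).toReal / (y - 1) := by
    intro x y hx hy hx1 hy1
    have hxy : 0 < y - x := by linarith
    have h := hf.toReal_combo_le hx hy (a := (y - 1) / (y - x)) (b := (1 - x) / (y - x))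
      (div_pos (by linarith) hxy) (div_pos (by linarith) hxy) (by field_simp; ring)
    have e : (y - 1) / (y - x) * x + (1 - x) / (y - x) * y = 1 := by field_simp; ring
    rw [e, hf.map_one] at h
    have h' : 0 ≤ (y - 1) / (y - x) * (f x).toReal + (1 - x) / (y - x) * (f y).toReal := by
      exact_mod_cast h
    have h2 : 0 ≤ (y - 1) * (f x).toReal + (1 - x) * (f y).toReal := by
      have := mul_nonneg hxy.le h'
      field_simp at this
      linarith
    rw [div_le_div_iff₀ (by linarith) (by linarith)]
    linarith
  set S : Set ℝ := {r | ∃ x, f x ≠ ⊤ ∧ x < 1 ∧ r = -(f x).toReal / (1 - x)} with hS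
  have hne : S.Nonempty := ⟨_, 1 - ε / 2, hfin _ (by
    rw [show 1 - ε / 2 - 1 = -(ε / 2) by ring, abs_neg, abs_of_pos (by linarith)]; linarith),
    by linarith, rfl⟩
  have hub : ∀ y, f y ≠ ⊤ → 1 < y → ∀ r ∈ S, r ≤ (f y).toReal / (y - 1) := by
    rintro y hy hy1 r ⟨x, hx, hx1, rfl⟩
    exact key x y hx hy hx1 hy1
  have hbdd : BddAbove S := ⟨_, fun r hr => hub (1 + ε / 2) (hfin _ (by
    rw [show 1 + ε / 2 - 1 = ε / 2 by ring, abs_of_pos (by linarith)]; linarith))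
    (by linarith) r hr⟩
  refine ⟨sSup S, fun x hx => ?_⟩
  rcases lt_trichotomy x 1 with h | rfl | h
  · have := le_csSup hbdd ⟨x, hx, h, rfl⟩
    rw [div_le_iff₀ (by linarith)] at this
    linarith
  · simp [hf.map_one]
  · have := csSup_le hne (hub x hx h)
    rw [le_div_iff₀ (by linarith)] at this
    linarith

/-- A proper convex lower semicontinuous function is the supremum of its affine minorants. -/
lemma exists_minorant_gt (hf : IsDivergenceFunction f) {x₀ r : ℝ} (hr : (r : EReal) < f x₀) :
    ∃ s u, IsScaledMinorant f 1 s u ∧ r < x₀ * s - u := by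
  obtain ⟨s₀, hs₀⟩ := hf.exists_subgradient
  set K : Set (ℝ × ℝ) := {p | f p.1 ≤ (p.2 : EReal)} with hK
  have hKclosed : IsClosed K := hf.lsc.isClosed_epigraph.preimage
    (continuous_fst.prodMk (continuous_coe_real_ereal.comp continuous_snd))
  have hKtop : ∀ p ∈ K, f p.1 ≠ ⊤ := fun p hp h => by
    rw [hK, mem_ofPred_eq, h] at hp
    exact absurd hp (by simp)
  have hKreal : ∀ p ∈ K, (f p.1).toReal ≤ p.2 := fun p hp => by
    rw [← EReal.coe_le_coe_iff, hf.coe_toReal (hKtop p hp)]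
    exact hp
  have hKconv : Convex ℝ K := by
    rw [convex_iff_forall_pos]
    intro p hp q hq a b ha hb hab
    refine (hf.toReal_combo_le (hKtop p hp) (hKtop q hq) ha hb hab).trans
      (EReal.coe_le_coe_iff.2 ?_)
    have h1 := mul_le_mul_of_nonneg_left (hKreal p hp) ha.le
    have h2 := mul_le_mul_of_nonneg_left (hKreal q hq) hb.le
    simpa using add_le_add h1 h2
  -- Separate `(x₀, r)` from the closed convex epigraph.
  obtain ⟨L, c, hL, hc⟩ := geometric_hahn_banach_closed_point hKconv hKclosed
    (x := (x₀, r)) (fun h => absurd hr (not_lt.2 h))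
  set α := L (1, 0)
  set β := L (0, 1)
  have hLe : ∀ x y, L (x, y) = x * α + y * β := fun x y => by
    have : ((x, y) : ℝ × ℝ) = x • (1, 0) + y • (0, 1) := by simp
    rw [this, map_add, map_smul, map_smul]; rfl
  rw [hLe] at hc
  have hdom : ∀ x, f x ≠ ⊤ → ∀ y, (f x).toReal ≤ y → x * α + y * β < c := fun x hx y hy => by
    rw [← hLe]
    refine hL _ ?_
    change f x ≤ (y : EReal)
    rw [← hf.coe_toReal hx]
    exact_mod_cast hy
  -- The epigraph contains the upward ray from `(1, 0)`, on which `L` is bounded above.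
  have hβ : β ≤ 0 := by
    by_contra! h
    have h1 : (f 1).toReal = 0 := by simp [hf.map_one]
    have := hdom 1 (by simp [hf.map_one]) (|c - α| / β) (by rw [h1]; positivity)
    rw [div_mul_cancel₀ _ h.ne'] at this
    linarith [le_abs_self (c - α)]
  rcases hβ.lt_or_eq with h | h
  · refine ⟨α / (-β), c / (-β), fun x hx => ?_, ?_⟩
    · have := hdom x hx _ le_rfl
      rw [one_mul, ← mul_div_assoc, ← sub_div, div_le_iff₀ (by linarith)]
      linarith
    · rw [← mul_div_assoc, ← sub_div, lt_div_iff₀ (by linarith)]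
      linarith
  -- Vertical hyperplane: `x * α - c` is negative on the effective domain and positive at `x₀`.
  -- Adding `k` times it to the subgradient minorant keeps a minorant, and `k` is large enough to
  -- exceed `r` at `x₀`.
  · simp only [h, mul_zero, add_zero] at hc hdom
    set k := (|r - (x₀ * s₀ - s₀)| + 1) / (x₀ * α - c) with hk
    have hpos : 0 < x₀ * α - c := by linarith
    have hk0 : 0 ≤ k := by positivity
    refine ⟨s₀ + k * α, s₀ + k * c, fun x hx => ?_, ?_⟩
    · have h1 := mul_le_mul_of_nonneg_left (hdom x hx _ le_rfl).le hk0
      linarith [hs₀ x hx]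
    · have : k * (x₀ * α - c) = |r - (x₀ * s₀ - s₀)| + 1 := div_mul_cancel₀ _ hpos.ne'
      linarith [le_abs_self (r - (x₀ * s₀ - s₀))]

end IsDivergenceFunction

end

/-! ## Expectations under finitely additive probabilities -/

section

variable {Ω : Type*} [MeasurableSpace Ω]

/-- The vector space `B(Ω, Σ)` of bounded measurable functions. -/
def boundedSubmodule (Ω : Type*) [MeasurableSpace Ω] : Submodule ℝ (Ω → ℝ) where
  carrier := boundedMeasurable Ω
  add_mem' := by
    rintro g h ⟨hg, C, hC⟩ ⟨hh, D, hD⟩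
    exact ⟨hg.add hh, C + D, fun x => (abs_add_le _ _).trans (add_le_add (hC x) (hD x))⟩
  zero_mem' := ⟨measurable_const, 0, by simp⟩
  smul_mem' := by
    rintro c g ⟨hg, C, hC⟩
    refine ⟨hg.const_smul c, |c| * C, fun x => ?_⟩
    rw [Pi.smul_apply, smul_eq_mul, abs_mul]
    exact mul_le_mul_of_nonneg_left (hC x) (abs_nonneg c)

lemma const_mem_boundedMeasurable (c : ℝ) : (fun _ => c) ∈ boundedMeasurable Ω :=
  ⟨measurable_const, |c|, fun _ => le_rfl⟩

lemma indicator_mem_boundedMeasurable {E : Set Ω} (hE : MeasurableSet E) :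
    E.indicator (fun _ => (1 : ℝ)) ∈ boundedMeasurable Ω := by
  refine ⟨measurable_const.indicator hE, 1, fun x => ?_⟩
  by_cases hx : x ∈ E <;> simp [hx]

/-- A constant function, as an element of `B(Ω, Σ)`. -/
def constFn (Ω : Type*) [MeasurableSpace Ω] (c : ℝ) : boundedSubmodule Ω :=
  ⟨fun _ => c, const_mem_boundedMeasurable c⟩

/-- The indicator function of a measurable set, as an element of `B(Ω, Σ)`. -/
noncomputable def indicatorFn {E : Set Ω} (hE : MeasurableSet E) : boundedSubmodule Ω :=
  ⟨E.indicator (fun _ => 1), indicator_mem_boundedMeasurable hE⟩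

@[simp] lemma constFn_apply (c : ℝ) (x : Ω) : (constFn Ω c).1 x = c := rfl

lemma indicatorFn_univ : indicatorFn (MeasurableSet.univ : MeasurableSet (univ : Set Ω)) =
    constFn Ω 1 :=
  Subtype.ext (indicator_univ _)

lemma indicatorFn_union {E F : Set Ω} (hE : MeasurableSet E) (hF : MeasurableSet F)
    (hd : Disjoint E F) : indicatorFn (hE.union hF) = indicatorFn hE + indicatorFn hF :=
  Subtype.ext (indicator_union_of_disjoint hd _)

lemma simpleFunc_mem_boundedMeasurable (s : SimpleFunc Ω ℝ) : ⇑s ∈ boundedMeasurable Ω := by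
  obtain ⟨C, hC⟩ := s.exists_forall_norm_le
  exact ⟨s.measurable, C, hC⟩

lemma integrable_of_mem_boundedMeasurable (μ : Measure Ω) [IsFiniteMeasure μ] {h : Ω → ℝ}
    (hh : h ∈ boundedMeasurable Ω) : Integrable h μ := by
  obtain ⟨hm, C, hC⟩ := hh
  exact Integrable.of_bound hm.aestronglyMeasurable C (Eventually.of_forall hC)

/-- Round `h` down to a multiple of `ε`; boundedness leaves finitely many values. -/
lemma exists_simpleFunc_abs_sub_le {h : Ω → ℝ} (hh : h ∈ boundedMeasurable Ω) {ε : ℝ}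
    (hε : 0 < ε) : ∃ s : SimpleFunc Ω ℝ, ∀ x, |h x - s x| ≤ ε := by
  obtain ⟨hm, C, hC⟩ := hh
  let k : SimpleFunc Ω ℤ :=
    { toFun := fun x => ⌊h x / ε⌋
      measurableSet_fiber' := fun y =>
        (Int.measurable_floor.comp (hm.div_const ε)) (measurableSet_singleton y)
      finite_range' := by
        refine (Set.finite_Icc ⌊-C / ε⌋ ⌊C / ε⌋).subset ?_
        rintro _ ⟨x, rfl⟩
        have := abs_le.1 (hC x)
        exact ⟨Int.floor_mono (div_le_div_of_nonneg_right this.1 hε.le),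
          Int.floor_mono (div_le_div_of_nonneg_right this.2 hε.le)⟩ }
  refine ⟨k.map (fun n : ℤ => ε * n), fun x => ?_⟩
  have h1 : (⌊h x / ε⌋ : ℝ) ≤ h x / ε := Int.floor_le _
  have h2 : h x / ε < ⌊h x / ε⌋ + 1 := Int.lt_floor_add_one _
  rw [le_div_iff₀ hε] at h1
  rw [div_lt_iff₀ hε] at h2
  change |h x - ε * (⌊h x / ε⌋ : ℝ)| ≤ ε
  rw [abs_le]
  constructor <;> linarith

/-- A positive linear functional on `B(Ω, Σ)` with `L 1 = 1` is `1`-Lipschitz. -/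
lemma abs_apply_sub_le (L : boundedSubmodule Ω →ₗ[ℝ] ℝ)
    (hpos : ∀ h : boundedSubmodule Ω, 0 ≤ h.1 → 0 ≤ L h)
    (hone : L (constFn Ω 1) = 1) {g h : boundedSubmodule Ω} {ε : ℝ}
    (hgh : ∀ x, |g.1 x - h.1 x| ≤ ε) : |L g - L h| ≤ ε := by
  have h1 := hpos (ε • (constFn Ω 1) - (g - h)) fun x => by
    simpa using (abs_le.1 (hgh x)).2
  have h2 := hpos (ε • (constFn Ω 1) + (g - h)) fun x => by
    have := (abs_le.1 (hgh x)).1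
    simp
    linarith
  rw [map_sub, map_smul, hone, map_sub] at h1
  rw [map_add, map_smul, hone, map_sub] at h2
  simp at h1 h2
  rw [abs_le]
  constructor <;> linarith

namespace FinAddProb

variable (P : FinAddProb Ω)

lemma toFun_union {s t : Set Ω} (hs : MeasurableSet s) (ht : MeasurableSet t)
    (hd : Disjoint s t) : P.toFun (s ∪ t) = P.toFun s + P.toFun t :=
  addContent_union' (m := P.toAddContent) hs ht (hs.union ht) hd

lemma toFun_ne_top {s : Set Ω} (hs : MeasurableSet s) : P.toFun s ≠ ⊤ := by
  have h := P.toFun_union hs hs.compl disjoint_compl_right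
  rw [union_compl_self, P.map_univ] at h
  exact ne_top_of_le_ne_top ENNReal.one_ne_top (h ▸ le_self_add)

/-- The expectation of a simple function. -/
noncomputable def simpleExpect (s : SimpleFunc Ω ℝ) : ℝ :=
  ∑ y ∈ s.range, y * (P.toFun (s ⁻¹' {y})).toReal

/-- `P` as an additive function with values in the continuous linear maps. -/
noncomputable def toCLM (s : Set Ω) : ℝ →L[ℝ] ℝ :=
  (P.toFun s).toReal • ContinuousLinearMap.id ℝ ℝ

lemma simpleExpect_eq (s : SimpleFunc Ω ℝ) : P.simpleExpect s = s.setToSimpleFunc P.toCLM := by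
  simp [simpleExpect, SimpleFunc.setToSimpleFunc, toCLM, mul_comm]

/-- Taking the zero measure as reference makes the finiteness and integrability side conditions of
`setToSimpleFunc` trivial, so its linearity applies to finitely additive `P`. -/
lemma finMeasAdditive_toCLM : FinMeasAdditive (0 : Measure Ω) P.toCLM := by
  intro s t hs ht _ _ hd
  rw [toCLM, P.toFun_union hs ht hd, ENNReal.toReal_add (P.toFun_ne_top hs) (P.toFun_ne_top ht),
    add_smul]
  rfl

lemma simpleExpect_add (s t : SimpleFunc Ω ℝ) :
    P.simpleExpect (s + t) = P.simpleExpect s + P.simpleExpect t := by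
  simp only [simpleExpect_eq]
  exact SimpleFunc.setToSimpleFunc_add _ P.finMeasAdditive_toCLM (by simp) (by simp)

lemma simpleExpect_smul (c : ℝ) (s : SimpleFunc Ω ℝ) :
    P.simpleExpect (c • s) = c * P.simpleExpect s := by
  simp only [simpleExpect_eq]
  exact SimpleFunc.setToSimpleFunc_smul_real _ P.finMeasAdditive_toCLM c (by simp)

lemma simpleExpect_nonneg {s : SimpleFunc Ω ℝ} (h : ∀ x, 0 ≤ s x) : 0 ≤ P.simpleExpect s := by
  refine Finset.sum_nonneg fun y hy => mul_nonneg ?_ ENNReal.toReal_nonneg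
  obtain ⟨x, rfl⟩ := SimpleFunc.mem_range.1 hy
  exact h x

lemma simpleExpect_mono {s t : SimpleFunc Ω ℝ} (h : ∀ x, s x ≤ t x) :
    P.simpleExpect s ≤ P.simpleExpect t := by
  have h1 : t = s + (t + (-1 : ℝ) • s) := by ext x; simp
  rw [h1, simpleExpect_add]
  refine le_add_of_nonneg_right (P.simpleExpect_nonneg fun x => ?_)
  simpa using h x

lemma nonempty (P : FinAddProb Ω) : Nonempty Ω := by
  by_contra h
  rw [not_nonempty_iff] at h
  have := P.map_univ
  rw [univ_eq_empty_iff.2 h, P.empty'] at this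
  exact zero_ne_one this

lemma simpleExpect_const (c : ℝ) : P.simpleExpect (SimpleFunc.const Ω c) = c := by
  have := P.nonempty
  have h : (SimpleFunc.const Ω c : Ω → ℝ) ⁻¹' {c} = univ := by ext; simp
  rw [simpleExpect, SimpleFunc.range_const, Finset.sum_singleton, h, P.map_univ]
  simp

/-- `s - ε` competes in the supremum defining `expect`, and every competitor lies below `s + ε`. -/
lemma abs_expect_sub_simpleExpect_le {h : Ω → ℝ} {s : SimpleFunc Ω ℝ} {ε : ℝ}
    (hs : ∀ x, |h x - s x| ≤ ε) : |P.expect h - P.simpleExpect s| ≤ ε := by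
  have hub : ∀ r ∈ {r : ℝ | ∃ s : SimpleFunc Ω ℝ, (∀ x, s x ≤ h x) ∧
      r = ∑ y ∈ s.range, y * (P.toFun (s ⁻¹' {y})).toReal}, r ≤ P.simpleExpect s + ε := by
    rintro r ⟨s', hs', rfl⟩
    rw [← P.simpleExpect_const ε, ← simpleExpect_add]
    refine P.simpleExpect_mono fun x => ?_
    have := (abs_le.1 (hs x)).2
    simp
    linarith [hs' x]
  have hmem : P.simpleExpect s - ε ∈ {r : ℝ | ∃ s : SimpleFunc Ω ℝ, (∀ x, s x ≤ h x) ∧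
      r = ∑ y ∈ s.range, y * (P.toFun (s ⁻¹' {y})).toReal} := by
    refine ⟨s + SimpleFunc.const Ω (-ε), fun x => ?_, ?_⟩
    · have := (abs_le.1 (hs x)).1
      simp
      linarith
    · change _ = P.simpleExpect _
      rw [simpleExpect_add, simpleExpect_const]
      ring
  have h1 : P.expect h ≤ P.simpleExpect s + ε := csSup_le ⟨_, hmem⟩ hub
  have h2 : P.simpleExpect s - ε ≤ P.expect h := le_csSup ⟨_, hub⟩ hmem
  rw [abs_le]
  constructor <;> linarith

lemma expect_simpleFunc (s : SimpleFunc Ω ℝ) : P.expect s = P.simpleExpect s := by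
  have := P.abs_expect_sub_simpleExpect_le (h := s) (s := s) (ε := 0) (by simp)
  exact sub_eq_zero.1 (abs_nonpos_iff.1 this)

lemma expect_add {g h : Ω → ℝ} (hg : g ∈ boundedMeasurable Ω) (hh : h ∈ boundedMeasurable Ω) :
    P.expect (g + h) = P.expect g + P.expect h := by
  refine eq_of_forall_dist_le fun ε hε => ?_
  rw [Real.dist_eq]
  obtain ⟨s, hs⟩ := exists_simpleFunc_abs_sub_le hg (ε := ε / 4) (by positivity)
  obtain ⟨t, ht⟩ := exists_simpleFunc_abs_sub_le hh (ε := ε / 4) (by positivity)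
  have h1 := abs_le.1 (P.abs_expect_sub_simpleExpect_le hs)
  have h2 := abs_le.1 (P.abs_expect_sub_simpleExpect_le ht)
  have h3 := P.abs_expect_sub_simpleExpect_le (h := g + h) (s := s + t) (ε := ε / 2) fun x => by
    have := abs_le.1 (hs x)
    have := abs_le.1 (ht x)
    rw [abs_le]
    simp only [Pi.add_apply, SimpleFunc.coe_add]
    constructor <;> linarith
  rw [simpleExpect_add] at h3
  replace h3 := abs_le.1 h3
  rw [abs_le]
  constructor <;> linarith

lemma expect_smul (c : ℝ) {h : Ω → ℝ} (hh : h ∈ boundedMeasurable Ω) :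
    P.expect (c • h) = c * P.expect h := by
  refine eq_of_forall_dist_le fun ε hε => ?_
  rw [Real.dist_eq]
  have hc : 0 < |c| + 1 := by positivity
  set δ := ε / (2 * (|c| + 1)) with hδ
  have hδ0 : 0 < δ := by positivity
  have hcδ : |c| * δ ≤ ε / 2 := by
    have : (|c| + 1) * δ = ε / 2 := by rw [hδ]; field_simp
    linarith
  obtain ⟨s, hs⟩ := exists_simpleFunc_abs_sub_le hh hδ0
  have h1 : |P.expect (c • h) - P.simpleExpect (c • s)| ≤ ε / 2 :=
    P.abs_expect_sub_simpleExpect_le fun x => by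
      simp only [Pi.smul_apply, SimpleFunc.coe_smul, smul_eq_mul, ← mul_sub, abs_mul]
      exact (mul_le_mul_of_nonneg_left (hs x) (abs_nonneg c)).trans hcδ
  have h2 : |c * P.simpleExpect s - c * P.expect h| ≤ ε / 2 := by
    rw [← mul_sub, abs_mul, abs_sub_comm]
    exact (mul_le_mul_of_nonneg_left (P.abs_expect_sub_simpleExpect_le hs) (abs_nonneg c)).trans hcδ
  rw [simpleExpect_smul] at h1
  exact (abs_sub_le _ _ _).trans (by linarith)

/-- The expectation as a linear functional on `B(Ω, Σ)`. -/
noncomputable def expectLinear : boundedSubmodule Ω →ₗ[ℝ] ℝ where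
  toFun h := P.expect h
  map_add' g h := P.expect_add g.2 h.2
  map_smul' c h := P.expect_smul c h.2

lemma expect_const (c : ℝ) : P.expect (fun _ => c) = c := by
  have := P.expect_simpleFunc (SimpleFunc.const Ω c)
  rwa [simpleExpect_const] at this

/-- The expectation is the only positive linear functional with given values on indicators. -/
lemma expect_eq_of_indicator (L : boundedSubmodule Ω →ₗ[ℝ] ℝ)
    (hpos : ∀ h : boundedSubmodule Ω, 0 ≤ h.1 → 0 ≤ L h)
    (hind : ∀ E (hE : MeasurableSet E),
      L (indicatorFn hE) = (P.toFun E).toReal)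
    (h : boundedSubmodule Ω) : P.expect h = L h := by
  have hone : L (constFn Ω 1) = 1 := by
    have := hind univ MeasurableSet.univ
    rw [P.map_univ, ENNReal.toReal_one] at this
    rwa [indicatorFn_univ] at this
  have hsimple : ∀ s : SimpleFunc Ω ℝ,
      L ⟨s, simpleFunc_mem_boundedMeasurable s⟩ = P.simpleExpect s := by
    intro s
    have hs : (⟨s, simpleFunc_mem_boundedMeasurable s⟩ : boundedSubmodule Ω) =
        ∑ y ∈ s.range, y • indicatorFn (s.measurableSet_fiber y) := by
      ext x
      simp only [indicatorFn, Submodule.coe_sum, Submodule.coe_smul, Finset.sum_apply,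
        Pi.smul_apply, smul_eq_mul]
      rw [Finset.sum_eq_single (s x)]
      · simp
      · intro y _ hy
        simp [hy.symm]
      · exact fun h => absurd (s.mem_range_self x) h
    rw [hs, map_sum, simpleExpect]
    refine Finset.sum_congr rfl fun y _ => ?_
    rw [map_smul, hind _ (s.measurableSet_fiber y), smul_eq_mul]
  refine eq_of_forall_dist_le fun ε hε => ?_
  rw [Real.dist_eq]
  obtain ⟨s, hs⟩ := exists_simpleFunc_abs_sub_le h.2 (ε := ε / 2) (by positivity)
  have h1 := P.abs_expect_sub_simpleExpect_le hs
  have h2 := abs_apply_sub_le L hpos hone (g := h)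
    (h := ⟨s, simpleFunc_mem_boundedMeasurable s⟩) hs
  rw [hsimple, abs_sub_comm] at h2
  exact (abs_sub_le _ _ _).trans (by linarith)

/-- A normalised positive linear functional on `B(Ω, Σ)` is the expectation of a finitely additive
probability measure. -/
lemma exists_expect_eq (L : boundedSubmodule Ω →ₗ[ℝ] ℝ)
    (hpos : ∀ h : boundedSubmodule Ω, 0 ≤ h.1 → 0 ≤ L h)
    (hone : L (constFn Ω 1) = 1) :
    ∃ P : FinAddProb Ω, (∀ h : boundedSubmodule Ω, P.expect h = L h) ∧
      ∀ E (hE : MeasurableSet E),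
        P.toFun E = ENNReal.ofReal (L (indicatorFn hE)) := by
  classical
  let m : Set Ω → ℝ≥0∞ := fun E =>
    if hE : MeasurableSet E then ENNReal.ofReal (L (indicatorFn hE)) else 0
  have hm : ∀ E (hE : MeasurableSet E),
      m E = ENNReal.ofReal (L (indicatorFn hE)) := fun E hE => dif_pos hE
  have hind0 : ∀ E (hE : MeasurableSet E), 0 ≤ L (indicatorFn hE) :=
    fun E hE => hpos _ fun x => indicator_nonneg (fun _ _ => zero_le_one) x
  have hring : IsSetRing {s : Set Ω | MeasurableSet s} :=
    ⟨MeasurableSet.empty, fun _ _ hs ht => hs.union ht, fun _ _ hs ht => hs.diff ht⟩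
  have hempty : m ∅ = 0 := by
    have : indicatorFn (MeasurableSet.empty : MeasurableSet (∅ : Set Ω)) = 0 :=
      Subtype.ext (indicator_empty _)
    rw [hm _ MeasurableSet.empty, this, map_zero, ENNReal.ofReal_zero]
  have hunion : ∀ {s t : Set Ω}, MeasurableSet s → MeasurableSet t → Disjoint s t →
      m (s ∪ t) = m s + m t := fun {s t} hs ht hd => by
    rw [hm _ hs, hm _ ht, hm _ (hs.union ht), indicatorFn_union hs ht hd, map_add,
      ENNReal.ofReal_add (hind0 s hs) (hind0 t ht)]
  let P : FinAddProb Ω :=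
    { hring.addContent_of_union m hempty hunion with
      map_univ := by
        change m univ = 1
        rw [hm _ MeasurableSet.univ, indicatorFn_univ, hone, ENNReal.ofReal_one] }
  refine ⟨P, P.expect_eq_of_indicator L hpos fun E hE => ?_, hm⟩
  change _ = (m E).toReal
  rw [hm E hE, ENNReal.toReal_ofReal (hind0 E hE)]

lemma toMeasure_apply (hP : P.IsCountablyAdditive) {E : Set Ω} (hE : MeasurableSet E) :
    P.toMeasure hP E = P.toFun E := Measure.ofMeasurable_apply E hE

lemma isProbabilityMeasure_toMeasure (hP : P.IsCountablyAdditive) :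
    IsProbabilityMeasure (P.toMeasure hP) :=
  ⟨by rw [P.toMeasure_apply hP MeasurableSet.univ, P.map_univ]⟩

lemma absolutelyContinuous_toMeasure (hP : P.IsCountablyAdditive) {Q : Measure Ω}
    (hPQ : P.AbsCont Q) : P.toMeasure hP ≪ Q :=
  Measure.AbsolutelyContinuous.mk fun E hE h => by
    rw [P.toMeasure_apply hP hE, hPQ E hE h]

lemma expect_eq_integral (hP : P.IsCountablyAdditive) {h : Ω → ℝ}
    (hh : h ∈ boundedMeasurable Ω) : P.expect h = ∫ x, h x ∂P.toMeasure hP := by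
  have := P.isProbabilityMeasure_toMeasure hP
  let L : boundedSubmodule Ω →ₗ[ℝ] ℝ :=
    { toFun := fun h => ∫ x, h.1 x ∂P.toMeasure hP
      map_add' := fun g h => integral_add (integrable_of_mem_boundedMeasurable _ g.2)
        (integrable_of_mem_boundedMeasurable _ h.2)
      map_smul' := fun c h => integral_const_mul c h.1 }
  refine P.expect_eq_of_indicator L (fun h hh => integral_nonneg hh) (fun E hE => ?_) ⟨h, hh⟩
  change ∫ x, E.indicator (fun _ => (1 : ℝ)) x ∂P.toMeasure hP = _
  rw [integral_indicator_const _ hE, measureReal_def, P.toMeasure_apply hP hE]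
  simp

end FinAddProb

end

/-! ## Extension of dominated functionals -/

section

variable {Ω : Type*} [MeasurableSpace Ω] {f : ℝ → EReal} {Q : Measure Ω} {D : ℝ}

/-- The cone generated by the epigraph of `h ↦ E_Q[f^*(h)] + D` on `B(Ω, Σ)`. -/
def epigraphCone (f : ℝ → EReal) (Q : Measure Ω) (D : ℝ) :
    PointedCone ℝ (boundedSubmodule Ω × ℝ) where
  -- The perspective parameter `t` makes the set closed under addition and scaling. The degenerate
  -- value `t = 0` is allowed so that the origin belongs to it.
  carrier := {p | ∃ t : ℝ, 0 ≤ t ∧ ∃ u : Ω → ℝ, Integrable u Q ∧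
    (∀ᵐ x ∂Q, IsScaledMinorant f t (p.1.1 x) (u x)) ∧ ∫ x, u x ∂Q + t * D ≤ p.2}
  add_mem' := by
    rintro p q ⟨t, ht, u, hu, hpu, hp⟩ ⟨t', ht', u', hu', hqu, hq⟩
    refine ⟨t + t', add_nonneg ht ht', u + u', hu.add hu', ?_, ?_⟩
    · filter_upwards [hpu, hqu] with x h h' using h.add h'
    · rw [integral_add' hu hu', Prod.snd_add]
      linarith
  zero_mem' := ⟨0, le_rfl, 0, integrable_zero _ _ _,
    Eventually.of_forall fun _ x _ => by simp, by simp⟩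
  smul_mem' := by
    rintro ⟨c, hc⟩ p ⟨t, ht, u, hu, hpu, hp⟩
    refine ⟨c * t, mul_nonneg hc ht, fun x => c * u x, hu.const_mul c, ?_, ?_⟩
    · filter_upwards [hpu] with x h using h.smul hc
    · rw [integral_const_mul]
      have := mul_le_mul_of_nonneg_left hp hc
      change _ ≤ c * p.2
      linarith

variable [IsProbabilityMeasure Q]

/-- The hypothesis `hD` made homogeneous, so that it holds on the whole cone. -/
lemma le_of_isScaledMinorant (hf : IsDivergenceFunction f)
    {L : boundedSubmodule Ω →ₗ[ℝ] ℝ} {W : Submodule ℝ (boundedSubmodule Ω)}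
    (hW : constFn Ω 1 ∈ W) (hL : L (constFn Ω 1) = 1)
    (hD : ∀ h ∈ W, ∀ u, Integrable u Q → (∀ᵐ x ∂Q, IsScaledMinorant f 1 (h.1 x) (u x)) →
      L h ≤ ∫ x, u x ∂Q + D)
    {h : boundedSubmodule Ω} (hh : h ∈ W) {t : ℝ} (ht : 0 ≤ t) {u : Ω → ℝ} (hu : Integrable u Q)
    (hhu : ∀ᵐ x ∂Q, IsScaledMinorant f t (h.1 x) (u x)) : L h ≤ ∫ x, u x ∂Q + t * D := by
  obtain ⟨s₀, hs₀⟩ := hf.exists_subgradient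
  -- As `t` may vanish, add `ε` times the subgradient minorant before dividing by `t + ε`; the extra
  -- `ε * s₀` cancels because `L 1 = 1` and `Q` has mass one. Then let `ε` tend to `0`.
  have key : ∀ ε > 0, L h ≤ ∫ x, u x ∂Q + (t + ε) * D := by
    intro ε hε
    have hc : 0 < t + ε := by linarith
    have hi : Integrable (fun x => u x + ε * s₀) Q := hu.add (integrable_const _)
    have := hD ((t + ε)⁻¹ • (h + (ε * s₀) • constFn Ω 1))
      (W.smul_mem _ (W.add_mem hh (W.smul_mem _ hW))) (fun x => (t + ε)⁻¹ * (u x + ε * s₀))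
      (hi.const_mul _) (by
        filter_upwards [hhu] with x hx
        have := (hx.add (hs₀.smul hε.le)).smul (inv_nonneg.2 hc.le)
        rw [mul_one, inv_mul_cancel₀ hc.ne'] at this
        simpa [mul_add] using this)
    rw [map_smul, map_add, map_smul, hL, integral_const_mul, integral_add hu (integrable_const _),
      integral_const] at this
    simp only [smul_eq_mul, mul_one, probReal_univ, one_mul] at this
    have h2 := mul_le_mul_of_nonneg_left this hc.le
    rw [mul_inv_cancel_left₀ hc.ne', mul_add, mul_inv_cancel_left₀ hc.ne'] at h2
    linarith
  by_contra! hlt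
  set δ := L h - (∫ x, u x ∂Q + t * D) with hδ
  have hδ0 : 0 < δ := by linarith
  have h1 := key (δ / (2 * (|D| + 1))) (by positivity)
  have h2 : δ / (2 * (|D| + 1)) * D ≤ δ / (2 * (|D| + 1)) * (|D| + 1) :=
    mul_le_mul_of_nonneg_left (by linarith [le_abs_self D]) (by positivity)
  have h3 : δ / (2 * (|D| + 1)) * (|D| + 1) = δ / 2 := by field_simp
  linarith

/-- A Hahn-Banach extension theorem for linear functionals dominated by `E_Q[f^*(h)] + D`. -/
lemma exists_dominated_extension (hf : IsDivergenceFunction f)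
    {L : boundedSubmodule Ω →ₗ[ℝ] ℝ} {W : Submodule ℝ (boundedSubmodule Ω)}
    (hW : constFn Ω 1 ∈ W) (hL : L (constFn Ω 1) = 1)
    (hD : ∀ h ∈ W, ∀ u, Integrable u Q → (∀ᵐ x ∂Q, IsScaledMinorant f 1 (h.1 x) (u x)) →
      L h ≤ ∫ x, u x ∂Q + D) :
    ∃ L' : boundedSubmodule Ω →ₗ[ℝ] ℝ, (∀ h ∈ W, L' h = L h) ∧
      ∀ h u, Integrable u Q → (∀ᵐ x ∂Q, IsScaledMinorant f 1 (h.1 x) (u x)) →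
        L' h ≤ ∫ x, u x ∂Q + D := by
  obtain ⟨s₀, hs₀⟩ := hf.exists_subgradient
  let e : boundedSubmodule Ω × ℝ →ₗ[ℝ] ℝ :=
    LinearMap.snd ℝ _ _ - L.comp (LinearMap.fst ℝ _ _)
  have he : ∀ h r, e (h, r) = r - L h := fun h r => rfl
  -- The functional `r - L h` is nonnegative on the part of the cone over `W`; extend it positively
  -- to all of `B(Ω, Σ) × ℝ`.
  obtain ⟨g, hg, hgpos⟩ := riesz_extension (epigraphCone f Q D) (e.toPMap (W.prod ⊤))
    (by
      rintro ⟨⟨h, r⟩, hh⟩ ⟨t, ht, u, hu, hhu, hr⟩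
      change 0 ≤ e (h, r)
      rw [he, sub_nonneg]
      exact (le_of_isScaledMinorant hf hW hL hD hh.1 ht hu hhu).trans hr)
    (by
      rintro ⟨h, r⟩
      obtain ⟨_, C, hC⟩ := h.2
      -- Shifting by this constant brings `h` below `s₀`, where the subgradient minorant serves with
      -- `t = 1` and `u = s₀`.
      refine ⟨⟨((s₀ - C) • constFn Ω 1, s₀ + D - r), W.smul_mem _ hW, trivial⟩,
        1, zero_le_one, fun _ => s₀, integrable_const _, Eventually.of_forall fun x => ?_, ?_⟩
      · refine hf.isScaledMinorant_mono ?_ hs₀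
        have := (abs_le.1 (hC x)).2
        simp
        linarith
      · simp)
  have hg' : ∀ h ∈ W, ∀ r, g (h, r) = r - L h := fun h hh r => hg ⟨(h, r), hh, trivial⟩
  have hsplit : ∀ h r, g (h, r) = g (h, 0) + r := fun h r => by
    have h1 : ((h, r) : boundedSubmodule Ω × ℝ) = (h, 0) + (0, r) := by simp
    rw [h1, map_add, hg' 0 W.zero_mem, map_zero, sub_zero]
  refine ⟨-(g.comp (LinearMap.inl ℝ _ _)), fun h hh => ?_, fun h u hu hhu => ?_⟩
  · change -(g (h, 0)) = _
    rw [hg' h hh]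
    ring
  · have := hgpos (h, ∫ x, u x ∂Q + D) ⟨1, zero_le_one, u, hu, hhu, by simp⟩
    rw [hsplit] at this
    change -(g (h, 0)) ≤ _
    linarith

/-- If `h ≤ 0` a.e., the minorant with `u = s₀` serves for `s₀ + c * h` for every `c ≥ 0`. So `c * L
h ≤ D` for all such `c`. -/
lemma nonpos_of_dominated (hf : IsDivergenceFunction f) {L : boundedSubmodule Ω →ₗ[ℝ] ℝ}
    (hL : L (constFn Ω 1) = 1)
    (hD : ∀ h u, Integrable u Q → (∀ᵐ x ∂Q, IsScaledMinorant f 1 (h.1 x) (u x)) →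
      L h ≤ ∫ x, u x ∂Q + D)
    {h : boundedSubmodule Ω} (hh : ∀ᵐ x ∂Q, h.1 x ≤ 0) : L h ≤ 0 := by
  obtain ⟨s₀, hs₀⟩ := hf.exists_subgradient
  have key : ∀ c, 0 ≤ c → c * L h ≤ D := fun c hc => by
    have := hD (s₀ • constFn Ω 1 + c • h) (fun _ => s₀) (integrable_const _) (by
      filter_upwards [hh] with x hx
      refine hf.isScaledMinorant_mono ?_ hs₀
      have := mul_nonpos_of_nonneg_of_nonpos hc hx
      simpa using this)
    rw [map_add, map_smul, map_smul, hL] at this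
    simp only [smul_eq_mul, mul_one, integral_const, probReal_univ, one_mul] at this
    linarith
  by_contra! hpos
  have := key ((|D| + 1) / L h) (by positivity)
  rw [div_mul_cancel₀ _ hpos.ne'] at this
  linarith [le_abs_self D]

end

/-! ## Duality -/

section

variable {Ω : Type*} [MeasurableSpace Ω] {f : ℝ → EReal} {Q : Measure Ω}

lemma eintegral_mono_ae {g k : Ω → EReal} (h : ∀ᵐ x ∂Q, g x ≤ k x) :
    eintegral Q g ≤ eintegral Q k := by
  refine EReal.sub_le_sub (EReal.coe_ennreal_le_coe_ennreal_iff.2 (lintegral_mono_ae ?_))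
    (EReal.coe_ennreal_le_coe_ennreal_iff.2 (lintegral_mono_ae ?_))
  · filter_upwards [h] with x hx using EReal.toENNReal_le_toENNReal hx
  · filter_upwards [h] with x hx using EReal.toENNReal_le_toENNReal (EReal.neg_le_neg_iff.2 hx)

lemma eintegral_coe {u : Ω → ℝ} (hu : Integrable u Q) :
    eintegral Q (fun x => (u x : EReal)) = ((∫ x, u x ∂Q : ℝ) : EReal) := by
  have hp : ∫⁻ x, ENNReal.ofReal (u x) ∂Q ≠ ⊤ := hu.lintegral_lt_top.ne
  have hn : ∫⁻ x, ENNReal.ofReal (-u x) ∂Q ≠ ⊤ := hu.neg.lintegral_lt_top.ne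
  rw [integral_eq_lintegral_pos_part_sub_lintegral_neg_part hu, eintegral, EReal.coe_sub,
    EReal.coe_ennreal_toReal hp, EReal.coe_ennreal_toReal hn]
  rfl

lemma exists_integrable_of_eintegral_ne_top {g : Ω → EReal} (hg : Measurable g) {v : Ω → ℝ}
    (hv : Integrable v Q) (hvg : ∀ᵐ x ∂Q, (v x : EReal) ≤ g x) (htop : eintegral Q g ≠ ⊤) :
    ∃ u : Ω → ℝ, Integrable u Q ∧ ∀ᵐ x ∂Q, g x = u x := by
  have hn : ∫⁻ x, (-(g x)).toENNReal ∂Q ≠ ⊤ := by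
    refine ne_top_of_le_ne_top hv.neg.lintegral_lt_top.ne (lintegral_mono_ae ?_)
    filter_upwards [hvg] with x hx
    exact EReal.toENNReal_le_toENNReal (y := ((-v x : ℝ) : EReal))
      (by rw [EReal.coe_neg]; exact EReal.neg_le_neg_iff.2 hx)
  have hp : ∫⁻ x, (g x).toENNReal ∂Q ≠ ⊤ := fun h => by
    refine htop ?_
    rw [eintegral, h, EReal.coe_ennreal_top]
    exact EReal.top_sub (by simpa using hn)
  have hpm : Measurable fun x => (g x).toENNReal := hg.ereal_toENNReal
  have hnm : Measurable fun x => (-(g x)).toENNReal := hg.neg.ereal_toENNReal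
  refine ⟨_, (integrable_toReal_of_lintegral_ne_top hpm.aemeasurable hp).sub
    (integrable_toReal_of_lintegral_ne_top hnm.aemeasurable hn), ?_⟩
  filter_upwards [ae_lt_top hpm hp, ae_lt_top hnm hn] with x h1 h2
  rw [lt_top_iff_ne_top, EReal.toENNReal_ne_top_iff] at h1 h2
  change g x = (((g x).toENNReal.toReal - (-(g x)).toENNReal.toReal : ℝ) : EReal)
  generalize g x = y at h1 h2
  induction y with
  | bot => simp at h2
  | top => simp at h1
  | coe r =>
    rw [← EReal.coe_neg, EReal.real_coe_toENNReal, EReal.real_coe_toENNReal,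
      ENNReal.toReal_ofReal', ENNReal.toReal_ofReal', EReal.coe_eq_coe_iff]
    rw [max_zero_sub_max_neg_zero_eq_self]

/-- Since `f^*(s) ≥ s` and `h` is bounded, the negative part is integrable: the extended integral is
either `∞` or a genuine one. -/
lemma exists_integrable_conj_eq [IsFiniteMeasure Q] (hf : IsDivergenceFunction f) {h : Ω → ℝ}
    (hh : h ∈ boundedMeasurable Ω) (htop : eintegral Q (fun x => conj f (h x)) ≠ ⊤) :
    ∃ u : Ω → ℝ, Integrable u Q ∧ (∀ᵐ x ∂Q, IsScaledMinorant f 1 (h x) (u x)) ∧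
      eintegral Q (fun x => conj f (h x)) = ((∫ x, u x ∂Q : ℝ) : EReal) := by
  obtain ⟨u, hu, hgu⟩ := exists_integrable_of_eintegral_ne_top
    (hf.conj_mono.measurable.comp hh.1) (integrable_of_mem_boundedMeasurable Q hh)
    (Eventually.of_forall fun x => hf.coe_le_conj (h x)) htop
  refine ⟨u, hu, ?_, ?_⟩
  · filter_upwards [hgu] with x hx using hf.conj_le_coe_iff.1 hx.le
  · rw [← eintegral_coe hu]
    exact le_antisymm (eintegral_mono_ae (hgu.mono fun x hx => hx.le))
      (eintegral_mono_ae (hgu.mono fun x hx => hx.ge))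

/-- The Fenchel inequality for `f`-divergences. -/
lemma integral_sub_eintegral_conj_le_fDiv [IsProbabilityMeasure Q] (hf : IsDivergenceFunction f)
    {μ : Measure Ω} [IsProbabilityMeasure μ] (hμ : μ ≪ Q) {h : Ω → ℝ}
    (hh : h ∈ boundedMeasurable Ω) :
    ((∫ x, h x ∂μ : ℝ) : EReal) - eintegral Q (fun x => conj f (h x)) ≤ fDiv f μ Q := by
  by_cases htop : eintegral Q (fun x => conj f (h x)) = ⊤
  · simp [htop]
  obtain ⟨u, hu, hhu, he⟩ := exists_integrable_conj_eq hf hh htop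
  have hi : Integrable (fun x => (μ.rnDeriv Q x).toReal • h x) Q :=
    (integrable_rnDeriv_smul_iff hμ).2 (integrable_of_mem_boundedMeasurable μ hh)
  rw [he, ← EReal.coe_sub, ← integral_rnDeriv_smul hμ, ← integral_sub hi hu,
    ← eintegral_coe (u := fun x => _ - u x) (hi.sub hu)]
  refine eintegral_mono_ae ?_
  filter_upwards [hhu] with x hx using hf.isScaledMinorant_iff.1 hx _

/-- The hard direction of the variational formula for `f`-divergences. -/
lemma fDiv_le_of_forall [IsProbabilityMeasure Q] (hf : IsDivergenceFunction f)
    {μ : Measure Ω} [IsProbabilityMeasure μ] (hμ : μ ≪ Q) {D : ℝ}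
    (hD : ∀ h ∈ boundedMeasurable Ω, ∀ u, Integrable u Q →
      (∀ x, IsScaledMinorant f 1 (h x) (u x)) → ∫ x, h x ∂μ ≤ ∫ x, u x ∂Q + D) :
    fDiv f μ Q ≤ D := by
  let A := {p : ℝ × ℝ // IsScaledMinorant f 1 p.1 p.2}
  obtain ⟨s₀, hs₀⟩ := hf.exists_subgradient
  have : Nonempty A := ⟨⟨(s₀, s₀), hs₀⟩⟩
  let a : ℕ → A := TopologicalSpace.denseSeq A
  let p : Ω → ℝ := fun x => (μ.rnDeriv Q x).toReal
  have hpm : Measurable p := (Measure.measurable_rnDeriv μ Q).ennreal_toReal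
  let v : ℕ → Ω → ℝ := fun k x => p x * (a k).1.1 - (a k).1.2
  have hvm : ∀ k, Measurable (v k) := fun k => (hpm.mul_const _).sub_const _
  -- Strict inequality is an open condition on the minorant, so a dense sequence of minorants
  -- already has supremum `f`.
  have hsup : ∀ x (r : ℝ), (r : EReal) < f (p x) → ∃ k, r < v k x := by
    intro x r hr
    obtain ⟨s, u, hsu, hlt⟩ := hf.exists_minorant_gt hr
    have ho : IsOpen {q : A | r < p x * q.1.1 - q.1.2} :=
      isOpen_lt continuous_const (by fun_prop)
    exact (TopologicalSpace.denseRange_denseSeq A).exists_mem_open ho ⟨⟨(s, u), hsu⟩, hlt⟩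
  -- `J n x` is the index of a largest value among `v 0 x, …, v n x`, chosen measurably, so `g n`
  -- below is their running maximum.
  let J : ℕ → Ω → ℕ := fun n => Nat.rec (fun _ => 0)
    (fun n Jn x => if v (Jn x) x ≤ v (n + 1) x then n + 1 else Jn x) n
  have hJ : ∀ n x, J (n + 1) x = if v (J n x) x ≤ v (n + 1) x then n + 1 else J n x :=
    fun n x => rfl
  have hvJ : ∀ {j : Ω → ℕ}, Measurable j → Measurable fun x => v (j x) x := fun hj =>
    (measurable_from_prod_countable_right (f := fun q : ℕ × Ω => v q.1 q.2) hvm).comp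
      (hj.prodMk measurable_id)
  have hJm : ∀ n, Measurable (J n) := fun n => by
    induction n with
    | zero => exact measurable_const
    | succ n ih =>
      exact Measurable.ite (measurableSet_le (hvJ ih) (hvm _)) measurable_const ih
  have hJle : ∀ n x, J n x ≤ n := fun n x => by
    induction n with
    | zero => exact le_rfl
    | succ n ih => rw [hJ]; split_ifs <;> omega
  let g : ℕ → Ω → ℝ := fun n x => v (J n x) x
  have hgm : ∀ n, Measurable (g n) := fun n => hvJ (hJm n)
  have hgmono : ∀ x, Monotone fun n => g n x := fun x => monotone_nat_of_le_succ fun n => by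
    simp only [g, hJ]
    split_ifs with h
    · exact h
    · exact le_rfl
  have hvg : ∀ n x, v n x ≤ g n x := fun n x => by
    cases n with
    | zero => exact le_rfl
    | succ n =>
      simp only [g, hJ]
      split_ifs with h
      · exact le_rfl
      · exact (not_le.1 h).le
  have hbdd : ∀ (c : ℕ → ℝ) n, (fun x => c (J n x)) ∈ boundedMeasurable Ω := fun c n =>
    ⟨(measurable_of_countable c).comp (hJm n), ∑ k ∈ Finset.range (n + 1), |c k|, fun x =>
      Finset.single_le_sum (f := fun k => |c k|) (fun _ _ => abs_nonneg _)
        (Finset.mem_range.2 (Nat.lt_succ_of_le (hJle n x)))⟩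
  -- The selected slope and intercept take finitely many values, so they are admissible as `h` and
  -- `u` in `hD`.
  have hgi : ∀ n, Integrable (g n) Q ∧ ∫ x, g n x ∂Q ≤ D := fun n => by
    have h1 := hbdd (fun k => (a k).1.1) n
    have h2 := integrable_of_mem_boundedMeasurable Q (hbdd (fun k => (a k).1.2) n)
    have hi : Integrable (fun x => (μ.rnDeriv Q x).toReal • (a (J n x)).1.1) Q :=
      (integrable_rnDeriv_smul_iff hμ).2 (integrable_of_mem_boundedMeasurable μ h1)
    refine ⟨hi.sub h2, ?_⟩
    have := hD _ h1 _ h2 fun x => (a (J n x)).2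
    rw [← integral_rnDeriv_smul hμ, ← sub_le_iff_le_add', ← integral_sub hi h2] at this
    exact this
  -- Monotone convergence is applied to the nonnegative differences `g n - g 0`.
  let k : Ω → ℝ≥0∞ := fun x => ⨆ n, ENNReal.ofReal (g n x - g 0 x)
  have hkm : Measurable k := Measurable.iSup fun n => ((hgm n).sub (hgm 0)).ennreal_ofReal
  have hk : ∫⁻ x, k x ∂Q ≤ ENNReal.ofReal (D - ∫ x, g 0 x ∂Q) := by
    rw [lintegral_iSup (f := fun n x => ENNReal.ofReal (g n x - g 0 x))
      (fun n => ((hgm n).sub (hgm 0)).ennreal_ofReal)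
      (fun m n hmn x => ENNReal.ofReal_le_ofReal (sub_le_sub_right (hgmono x hmn) _))]
    refine iSup_le fun n => ?_
    rw [← ofReal_integral_eq_lintegral_ofReal (f := fun x => g n x - g 0 x)
      ((hgi n).1.sub (hgi 0).1)
      (Eventually.of_forall fun x => sub_nonneg.2 (hgmono x n.zero_le)),
      integral_sub (hgi n).1 (hgi 0).1]
    exact ENNReal.ofReal_le_ofReal (sub_le_sub_right (hgi n).2 _)
  have hktop : ∫⁻ x, k x ∂Q ≠ ⊤ := ne_top_of_le_ne_top ENNReal.ofReal_ne_top hk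
  have hki := integrable_toReal_of_lintegral_ne_top hkm.aemeasurable hktop
  have hfk : ∀ᵐ x ∂Q, f (p x) ≤ (((k x).toReal + g 0 x : ℝ) : EReal) := by
    filter_upwards [ae_lt_top hkm hktop] with x hx
    by_contra! hlt
    obtain ⟨n, hn⟩ := hsup x _ hlt
    have h1 : ENNReal.ofReal (g n x - g 0 x) ≤ k x :=
      le_iSup (fun n => ENNReal.ofReal (g n x - g 0 x)) n
    have h2 := (ENNReal.ofReal_le_iff_le_toReal hx.ne).1 h1
    linarith [hvg n x]
  refine (eintegral_mono_ae hfk).trans ?_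
  rw [eintegral_coe (u := fun x => (k x).toReal + g 0 x) (hki.add (hgi 0).1), EReal.coe_le_coe_iff,
    integral_add hki (hgi 0).1,
    integral_toReal hkm.aemeasurable (ae_lt_top hkm hktop)]
  have h1 := ENNReal.toReal_mono ENNReal.ofReal_ne_top hk
  rw [ENNReal.toReal_ofReal (sub_nonneg.2 (hgi 0).2)] at h1
  linarith

/-- Weak duality: `D_f` dominates all terms of its variational formula. -/
lemma expect_sub_le_extFDiv [IsProbabilityMeasure Q] (hf : IsDivergenceFunction f)
    (P : FinAddProb Ω) {h : Ω → ℝ} (hh : h ∈ boundedMeasurable Ω) :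
    ((P.expect h : ℝ) : EReal) - eintegral Q (fun x => conj f (h x)) ≤ extFDiv f P Q := by
  rw [extFDiv]
  split_ifs with hP
  · have := P.isProbabilityMeasure_toMeasure hP.1
    rw [P.expect_eq_integral hP.1 hh]
    exact integral_sub_eintegral_conj_le_fDiv hf (P.absolutelyContinuous_toMeasure hP.1 hP.2) hh
  · exact le_iSup₂ (f := fun h (_ : h ∈ boundedMeasurable Ω) =>
      ((P.expect h : ℝ) : EReal) - eintegral Q (fun x => conj f (h x))) h hh

lemma extFDiv_le_of_dominated [IsProbabilityMeasure Q] (hf : IsDivergenceFunction f)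
    {P : FinAddProb Ω} {D : ℝ}
    (hD : ∀ h ∈ boundedMeasurable Ω, ∀ u, Integrable u Q →
      (∀ᵐ x ∂Q, IsScaledMinorant f 1 (h x) (u x)) → P.expect h ≤ ∫ x, u x ∂Q + D) :
    extFDiv f P Q ≤ D := by
  rw [extFDiv]
  split_ifs with hP
  · have := P.isProbabilityMeasure_toMeasure hP.1
    refine fDiv_le_of_forall hf (P.absolutelyContinuous_toMeasure hP.1 hP.2) fun h hh u hu hhu => ?_
    rw [← P.expect_eq_integral hP.1 hh]
    exact hD h hh u hu (Eventually.of_forall hhu)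
  · refine iSup₂_le fun h hh => ?_
    by_cases htop : eintegral Q (fun x => conj f (h x)) = ⊤
    · simp [htop]
    obtain ⟨u, hu, hhu, he⟩ := exists_integrable_conj_eq hf hh htop
    rw [he, ← EReal.coe_sub, EReal.coe_le_coe_iff]
    linarith [hD h hh u hu hhu]

section LinearFDiv

variable {n : ℕ} {φ : Fin n → Ω → ℝ}

/-- The map `(a, b) ↦ aᵀφ + b` into `B(Ω, Σ)`. -/
noncomputable def affineMap (hφ : ∀ i, φ i ∈ boundedMeasurable Ω) :
    (Fin n → ℝ) × ℝ →ₗ[ℝ] boundedSubmodule Ω :=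
  (Fintype.linearCombination ℝ fun i => (⟨φ i, hφ i⟩ : boundedSubmodule Ω)).coprod
    (LinearMap.toSpanSingleton ℝ _ (constFn Ω 1))

lemma affineMap_apply (hφ : ∀ i, φ i ∈ boundedMeasurable Ω) (a : Fin n → ℝ) (b : ℝ) :
    (affineMap hφ (a, b)).1 = fun x => (∑ i, a i * φ i x) + b := by
  ext x
  simp [affineMap, Fintype.linearCombination_apply]

lemma le_linearFDiv (f : ℝ → EReal) (φ : Fin n → Ω → ℝ) (P : FinAddProb Ω) (Q : Measure Ω)
    (a : Fin n → ℝ) (b : ℝ) :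
    ((P.expect (fun x => (∑ i, a i * φ i x) + b) : ℝ) : EReal) -
      eintegral Q (fun x => conj f ((∑ i, a i * φ i x) + b)) ≤ linearFDiv f φ univ P Q :=
  le_iSup₂_of_le a (mem_univ a) (le_iSup (fun b : ℝ =>
    ((P.expect (fun x => (∑ i, a i * φ i x) + b) : ℝ) : EReal) -
      eintegral Q (fun x => conj f ((∑ i, a i * φ i x) + b))) b)

/-- Test with `a = 0` and `b` a subgradient `s` at `1`, for which `f^*(s) ≤ s`. This excludes the
value `⊥`. -/
lemma linearFDiv_nonneg [IsProbabilityMeasure Q] (hf : IsDivergenceFunction f)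
    (P : FinAddProb Ω) : 0 ≤ linearFDiv f φ univ P Q := by
  obtain ⟨s, hs⟩ := hf.exists_subgradient
  refine le_trans ?_ (le_linearFDiv f φ P Q 0 s)
  simp only [Pi.zero_apply, zero_mul, Finset.sum_const_zero, zero_add, P.expect_const]
  have h : eintegral Q (fun _ => conj f s) ≤ (s : EReal) := by
    refine (eintegral_mono_ae (k := fun _ => (s : EReal))
      (Eventually.of_forall fun _ => hf.conj_le_coe_iff.2 hs)).trans ?_
    rw [eintegral_coe (integrable_const s)]
    simp
  calc (0 : EReal) = (s : EReal) - s := by rw [← EReal.coe_sub, sub_self, EReal.coe_zero]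
    _ ≤ _ := EReal.sub_le_sub le_rfl h

lemma linearFDiv_le_extFDiv [IsProbabilityMeasure Q] (hf : IsDivergenceFunction f)
    (hφ : ∀ i, φ i ∈ boundedMeasurable Ω) {P P' : FinAddProb Ω}
    (hP' : ∀ i, P'.expect (φ i) = P.expect (φ i)) :
    linearFDiv f φ univ P Q ≤ extFDiv f P' Q := by
  have he : ∀ a b, P.expectLinear (affineMap hφ (a, b)) = P'.expectLinear (affineMap hφ (a, b)) := by
    intro a b
    simp only [affineMap, LinearMap.coprod_apply, Fintype.linearCombination_apply,
      LinearMap.toSpanSingleton_apply, map_add, map_sum, map_smul]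
    congr 1
    · exact Finset.sum_congr rfl fun i _ => congrArg (a i • ·) (hP' i).symm
    · exact congrArg (b • ·) ((P.expect_const 1).trans (P'.expect_const 1).symm)
  refine iSup₂_le fun a _ => iSup_le fun b => ?_
  have h1 := he a b
  have h2 := (affineMap hφ (a, b)).2
  change P.expect (affineMap hφ (a, b)).1 = P'.expect (affineMap hφ (a, b)).1 at h1
  rw [affineMap_apply] at h1 h2
  rw [h1]
  exact expect_sub_le_extFDiv hf P' h2

/-- Strong duality, with a minimiser. -/
lemma exists_extFDiv_le_linearFDiv [IsProbabilityMeasure Q] (hf : IsDivergenceFunction f)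
    (hφ : ∀ i, φ i ∈ boundedMeasurable Ω) (P : FinAddProb Ω)
    (htop : linearFDiv f φ univ P Q ≠ ⊤) :
    ∃ P' : FinAddProb Ω, (∀ i, P'.expect (φ i) = P.expect (φ i)) ∧ P'.AbsCont Q ∧
      extFDiv f P' Q ≤ linearFDiv f φ univ P Q := by
  obtain ⟨D, hDeq⟩ : ∃ D : ℝ, linearFDiv f φ univ P Q = D :=
    ⟨_, (EReal.coe_toReal htop (ne_bot_of_le_ne_bot EReal.zero_ne_bot
      (linearFDiv_nonneg hf P))).symm⟩
  have hone : P.expectLinear (constFn Ω 1) = 1 := P.expect_const 1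
  have hmem : constFn Ω 1 ∈ LinearMap.range (affineMap hφ) := ⟨(0, 1), by simp [affineMap]⟩
  obtain ⟨L, hLext, hL⟩ := exists_dominated_extension (Q := Q) (D := D) hf hmem hone (by
    rintro _ ⟨⟨a, b⟩, rfl⟩ u hu hau
    change P.expect (affineMap hφ (a, b)).1 ≤ _
    rw [affineMap_apply] at hau ⊢
    have h1 := le_linearFDiv f φ P Q a b
    have h2 : eintegral Q (fun x => conj f ((∑ i, a i * φ i x) + b)) ≤
        ((∫ x, u x ∂Q : ℝ) : EReal) := by
      rw [← eintegral_coe hu]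
      exact eintegral_mono_ae (hau.mono fun x hx => hf.conj_le_coe_iff.2 hx)
    have h3 := (EReal.sub_le_sub le_rfl h2).trans h1
    rw [hDeq, ← EReal.coe_sub, EReal.coe_le_coe_iff] at h3
    linarith)
  have hL1 : L (constFn Ω 1) = 1 := (hLext _ hmem).trans hone
  have hnonpos : ∀ {h : boundedSubmodule Ω}, (∀ᵐ x ∂Q, h.1 x ≤ 0) → L h ≤ 0 :=
    nonpos_of_dominated hf hL1 hL
  obtain ⟨P', hP', hset⟩ := FinAddProb.exists_expect_eq L (fun h hh => by
    have := hnonpos (h := -h) (Eventually.of_forall fun x => neg_nonpos.2 (hh x))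
    rw [map_neg] at this
    linarith) hL1
  refine ⟨P', fun i => ?_, fun E hE hQE => ?_, ?_⟩
  · have hi : (⟨φ i, hφ i⟩ : boundedSubmodule Ω) ∈ LinearMap.range (affineMap hφ) :=
      ⟨(Pi.single i 1, 0), by simp [affineMap, Fintype.linearCombination_apply_single]⟩
    exact (hP' ⟨φ i, hφ i⟩).trans (hLext _ hi)
  · rw [hset E hE, ENNReal.ofReal_eq_zero]
    refine hnonpos ?_
    -- The indicator of a `Q`-null set is a.e. nonpositive, so `L` is at most `0` on it.
    filter_upwards [measure_eq_zero_iff_ae_notMem.1 hQE] with x hx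
    exact (indicator_of_notMem hx fun _ => (1 : ℝ)).le
  · rw [hDeq]
    refine extFDiv_le_of_dominated hf fun h hh u hu hhu => ?_
    rw [hP' ⟨h, hh⟩]
    exact hL ⟨h, hh⟩ u hu hhu

end LinearFDiv

end

end RestrictedFDiv

theorem corollary3 {Ω : Type*} [MeasurableSpace Ω] {n : ℕ}
    (f : ℝ → EReal) (hf : RestrictedFDiv.IsDivergenceFunction f)
    (φ : Fin n → Ω → ℝ) (hφ : ∀ i, φ i ∈ RestrictedFDiv.boundedMeasurable Ω)
    (P : RestrictedFDiv.FinAddProb Ω)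
    (Q : MeasureTheory.Measure Ω) [MeasureTheory.IsProbabilityMeasure Q] :
    RestrictedFDiv.linearFDiv f φ Set.univ P Q =
        (⨅ P' ∈ {P' : RestrictedFDiv.FinAddProb Ω | ∀ i, P'.expect (φ i) = P.expect (φ i)},
          RestrictedFDiv.extFDiv f P' Q) ∧
    RestrictedFDiv.linearFDiv f φ Set.univ P Q =
        (⨅ P' ∈ {P' : RestrictedFDiv.FinAddProb Ω |
            (∀ i, P'.expect (φ i) = P.expect (φ i)) ∧ P'.AbsCont Q},
          RestrictedFDiv.extFDiv f P' Q) := by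
  refine ⟨le_antisymm
    (le_iInf₂ fun P' hP' => RestrictedFDiv.linearFDiv_le_extFDiv hf hφ hP') ?_, le_antisymm
    (le_iInf₂ fun P' hP' => RestrictedFDiv.linearFDiv_le_extFDiv hf hφ hP'.1) ?_⟩
  all_goals
    by_cases htop : RestrictedFDiv.linearFDiv f φ Set.univ P Q = ⊤
    · exact htop ▸ le_top
    obtain ⟨P', hφP', hac, hle⟩ := RestrictedFDiv.exists_extFDiv_le_linearFDiv hf hφ P htop
  · exact (iInf₂_le P' hφP').trans hle
  · exact (iInf₂_le P' ⟨hφP', hac⟩).trans hle
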